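/- Let $\mathbb R^n$ and $\mathbb R^m$ be Euclidean spaces, each endowed with an inner product $\langle\cdot,\cdot\rangle$ and with an arbitrary norm $\|\cdot\|$ (not necessarily the one induced by the inner product). For a Euclidean space $V$ with norm $\|\cdot\|$, the dual norm is $\|u\|^*=\max\{\langle u,x\rangle : x\in V,\ \|x\|\le 1\}$; a linear subspace of $\mathbb R^m$ is regarded as a Euclidean space with the inherited inner product and the restricted norm. Let $\Phi:\mathbb R^n\rightrightarrows\mathbb R^m$ be a set-valued mapping whose graph $\mathcal G=\operatorname{graph}(\Phi)=\{(x,y): y\in\Phi(x)\}$ is a nonempty polyhedron (that is, $\Phi$ is polyhedral). Call a set-valued mapping *sublinear* if its graph is a convex cone, and *relatively surjective* if its image (the projection of its graph to $\mathbb R^m$) is a linear subspace. For $z\in\mathcal G$ let $T_{\mathcal G}(z)=\{d: z+td\in\mathcal G\text{ for some }t>0\}$ be the tangent cone, let $\mathcal T(\mathcal G)=\{T_{\mathcal G}(z): z\in\mathcal G\}$, and for $T\in\mathcal T(\mathcal G)$ let $\Phi_T$ be the set-valued mapping with graph $T$. Let $\mathcal S(\Phi)=\{T\in\mathcal T(\mathcal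 G):\Phi_T\text{ is relatively surjective}\}$ and define $$\|\Psi^{-1}\|=\max_{y\in\operatorname{Im}(\Psi),\ \|y\|\le1}\ \min_{x:\,y\in\Psi(x)}\|x\|\quad\text{for }\Psi\text{ sublinear},\qquad \mathcal H(\Phi)=\max_{T\in\mathcal S(\Phi)}\|\Phi_T^{-1}\|.$$ Here the extrema in the definition of $\|\Psi^{-1}\|$ are understood as a supremum and an infimum in $[0,\infty]$. The upper adjoint of a sublinear $\Psi$ is given by $u\in\Psi^*(v)\iff\langle u,x\rangle\le\langle v,y\rangle$ for all $(x,y)\in\operatorname{graph}(\Psi)$. For sublinear, relatively surjective $\Psi$, let $\Pi_{\operatorname{Im}(\Psi)}:\mathbb R^m\to\operatorname{Im}(\Psi)$ be the orthogonal projection, and let $\|\Pi_{\operatorname{Im}(\Psi)}(v)\|^*$ be the dual norm in the space $\operatorname{Im}(\Psi)$, i.e. $\max\{\langle v,y\rangle: y\in\operatorname{Im}(\Psi),\ \|y\|\le1\}$. A minimum over the empty set is $+\infty$, and $1/(+\infty)=0$. **(a)** If $\Phi$ is sublinear and relatively surjective, then $\mathcal H(\Phi)$ is finite and $$\mathcal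 H(\Phi)=\frac{1}{\min\{\|u\|^*:\ u\in\Phi^*(v),\ \|\Pi_{\operatorname{Im}(\Phi)}(v)\|^*=1\}}.$$ **(b)** Suppose $\mathfrak F\subseteq\mathcal S(\Phi)$ and $\mathfrak J\subseteq\mathcal T(\mathcal G)\setminus\mathcal S(\Phi)$ are such that for every $T\in\mathcal T(\mathcal G)$ either $F\subseteq T$ for some $F\in\mathfrak F$ or $T\subseteq I$ for some $I\in\mathfrak J$. Then $\mathcal H(\Phi)$ is finite and $$\mathcal H(\Phi)=\max_{T\in\mathfrak F}\|\Phi_T^{-1}\|=\max_{T\in\mathfrak F}\ \frac{1}{\min\{\|u\|^*:\ u\in\Phi_T^*(v),\ \|\Pi_{\operatorname{Im}(\Phi_T)}(v)\|^*=1\}}.$$ The minima over $(u,v)$ are attained whenever there is a feasible pair, and the maxima over $\mathfrak F$ are attained. -/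

import Mathlib

open scoped ENNReal RealInnerProductSpace

namespace SetMap

section Basic

variable {E F : Type*}

/-- The graph of a set-valued mapping `Φ : E ⇉ F`. -/
def graph (Φ : E → Set F) : Set (E × F) := {z | z.2 ∈ Φ z.1}

/-- The set-valued mapping `Φ_K` whose graph is `K`. -/
def ofGraph (K : Set (E × F)) : E → Set F := fun x => {y | (x, y) ∈ K}

/-- The inverse set-valued mapping: `x ∈ Φ⁻¹(y)` iff `y ∈ Φ(x)`. -/
def inv (Φ : E → Set F) : F → Set E := fun y => {x | y ∈ Φ x}

/-- The domain of a set-valued mapping. -/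
def dom (Φ : E → Set F) : Set E := {x | ∃ y, (x, y) ∈ graph Φ}

/-- The image of a set-valued mapping. -/
def im (Φ : E → Set F) : Set F := {y | ∃ x, (x, y) ∈ graph Φ}

end Basic

section Linear

variable {V : Type*} [AddCommGroup V] [Module ℝ V]

/-- A polyhedron: the solution set of a finite system of linear inequalities. -/
def IsPolyhedron (Q : Set V) : Prop :=
  ∃ (k : ℕ) (f : Fin k → V →ₗ[ℝ] ℝ) (b : Fin k → ℝ), Q = {z | ∀ i, f i z ≤ b i}

/-- The tangent cone `T_Q(z)` to a polyhedron `Q` at `z ∈ Q`. -/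
def tangentCone (Q : Set V) (z : V) : Set V := {d | ∃ t : ℝ, 0 < t ∧ z + t • d ∈ Q}

/-- The collection `𝒯(Q)` of all tangent cones to `Q` at points of `Q`. -/
def tangentCones (Q : Set V) : Set (Set V) := {T | ∃ z ∈ Q, T = tangentCone Q z}

end Linear

section Maps

variable {E F : Type*} [AddCommGroup E] [Module ℝ E] [AddCommGroup F] [Module ℝ F]

/-- `Φ` is polyhedral if its graph is a polyhedron. -/
def IsPolyhedral (Φ : E → Set F) : Prop := IsPolyhedron (graph Φ)

/-- `Φ` is sublinear if its graph is a convex cone. -/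
def IsSublinear (Φ : E → Set F) : Prop := ∃ K : ConvexCone ℝ (E × F), (K : Set (E × F)) = graph Φ

/-- `Φ` is relatively surjective if its image is a linear subspace. -/
def IsRelSurjective (Φ : E → Set F) : Prop := ∃ L : Submodule ℝ F, (L : Set F) = im Φ

/-- The collection `𝒮(Φ) = 𝒮(graph Φ)` of the tangent cones `T` to `graph Φ` for which `Φ_T` is
relatively surjective. -/
def relSurjCones (Φ : E → Set F) : Set (Set (E × F)) :=
  {T | T ∈ tangentCones (graph Φ) ∧ IsRelSurjective (ofGraph T)}

/-- The norm `‖Φ‖ = max_{x ∈ dom Φ, ‖x‖ ≤ 1} min_{y ∈ Φ(x)} ‖y‖` of a set-valued mapping, where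
`p` is the norm of `E` and `q` is the norm of `F`. It takes values in `[0, ∞]`, with the extrema taken as supremum and infimum. -/
noncomputable def mapNorm (p : Seminorm ℝ E) (q : Seminorm ℝ F) (Φ : E → Set F) : ℝ≥0∞ :=
  ⨆ x ∈ {x | x ∈ dom Φ ∧ p x ≤ 1}, ⨅ y ∈ Φ x, ENNReal.ofReal (q y)

/-- The norm `‖Φ⁻¹‖` of the inverse mapping. -/
noncomputable def invNorm (p : Seminorm ℝ E) (q : Seminorm ℝ F) (Φ : E → Set F) : ℝ≥0∞ :=
  mapNorm q p (inv Φ)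

/-- The Hoffman constant `ℋ(Φ) = max_{T ∈ 𝒮(graph Φ)} ‖Φ_T⁻¹‖`. -/
noncomputable def hoffman (p : Seminorm ℝ E) (q : Seminorm ℝ F) (Φ : E → Set F) : ℝ≥0∞ :=
  ⨆ T ∈ relSurjCones Φ, invNorm p q (ofGraph T)

end Maps

section Duality

/-- The dual norm `‖u‖* = max_{‖x‖ ≤ 1} ⟨u, x⟩`, where the norm `‖·‖` is `p`, which need not be
the norm that comes from the inner product of `V`. -/
noncomputable def dualNorm {V : Type*} [NormedAddCommGroup V] [InnerProductSpace ℝ V]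
    (p : Seminorm ℝ V) (u : V) : ℝ := sSup {r | ∃ x : V, p x ≤ 1 ∧ r = ⟪u, x⟫}

variable {E F : Type*} [NormedAddCommGroup E] [InnerProductSpace ℝ E]
  [NormedAddCommGroup F] [InnerProductSpace ℝ F]

/-- The upper adjoint: `u ∈ Φ*(v)` iff `⟨u, x⟩ ≤ ⟨v, y⟩` for all `(x, y) ∈ graph Φ`. -/
def upperAdjoint (Φ : E → Set F) : F → Set E :=
  fun v => {u | ∀ z ∈ graph Φ, ⟪u, z.1⟫ ≤ ⟪v, z.2⟫}

variable [FiniteDimensional ℝ F]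

/-- `‖Π_{Im Φ}(v)‖*` for a relatively surjective `Φ`: the orthogonal projection of `v` onto the
subspace `L = Im Φ` (which equals the span of `Im Φ`) is an element of the Euclidean space `L`.
Its dual norm is the one of `L`, endowed with the inherited inner product and with the restriction
of the norm `q` to `L`. -/
noncomputable def projDualNorm (q : Seminorm ℝ F) (Φ : E → Set F) (v : F) : ℝ :=
  dualNorm (q.comp (Submodule.span ℝ (im Φ)).subtype)
    ((Submodule.span ℝ (im Φ)).orthogonalProjectionOnto v)

/-- The pairs `(u, v)` with `u ∈ Φ*(v)` and `‖Π_{Im Φ}(v)‖* = 1`. -/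
def dualFeasible (q : Seminorm ℝ F) (Φ : E → Set F) : Set (E × F) :=
  {w | w.1 ∈ upperAdjoint Φ w.2 ∧ projDualNorm q Φ w.2 = 1}

/-- The minimum of `‖u‖*` over the pairs `(u, v)` with `u ∈ Φ*(v)` and `‖Π_{Im Φ}(v)‖* = 1`,
as an element of `[0, ∞]`; it is `∞` if there is no such pair. -/
noncomputable def dualMin (p : Seminorm ℝ E) (q : Seminorm ℝ F) (Φ : E → Set F) : ℝ≥0∞ :=
  ⨅ w ∈ dualFeasible q Φ, ENNReal.ofReal (dualNorm p w.1)

/-- The minimum that defines `dualMin` is attained, unless there is no feasible pair. -/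
def DualMinAttained (p : Seminorm ℝ E) (q : Seminorm ℝ F) (Φ : E → Set F) : Prop :=
  (dualFeasible q Φ).Nonempty →
    ∃ w ∈ dualFeasible q Φ, IsMinOn (fun w : E × F => dualNorm p w.1) (dualFeasible q Φ) w

end Duality

end SetMap

/-! The proof combines conic duality for one cone with a comparison of tangent cones.

Duality: let `C` be a convex cone whose image is a subspace `L`. The distance `fiberDist` from `x`
to the fiber of `C` over `y` is a finite sublinear function on `E × L`, and `‖Φ_C⁻¹‖` is its maximum
`h` over the points `(0, y)` with `y` in the unit ball of `L`. Every feasible `(u, v)` satisfies `1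
≤ ‖u‖* h` (`one_le_dualNorm_mul_fiberDist`). If `h > 0`, Hahn–Banach gives a linear functional below
`fiberDist` that touches it at a maximizer; its two components, divided by `h`, form an optimal pair
(`exists_dualFeasible_dualNorm_le`).

Comparison: a polyhedron has finitely many tangent cones. If `S ⊆ T` are two of them and the image
of `S` is a subspace, the images agree (`im_ofGraph_eq_of_subset`), so `‖Φ_T⁻¹‖ ≤ ‖Φ_S⁻¹‖`. Hence no
cone of `𝒮(Φ)` lies inside a member of `𝔍`, each contains a member of `𝔉`, and the maximum over `𝔉`
suffices. Part (a) is the case `𝔉 = {graph Φ}`, `𝔍 = ∅`. -/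

namespace SetMap

/-! ### Dual norms in finite dimension. -/

section SeminormDuality

variable {V : Type*} [NormedAddCommGroup V] [InnerProductSpace ℝ V] [FiniteDimensional ℝ V]

theorem continuous_seminorm (p : Seminorm ℝ V) : Continuous p :=
  p.convexOn.locallyLipschitz.continuous

theorem exists_norm_le_mul_seminorm (p : Seminorm ℝ V) (hp : ∀ x, p x = 0 → x = 0) :
    ∃ c : ℝ, 0 < c ∧ ∀ x, ‖x‖ ≤ c * p x := by
  rcases subsingleton_or_nontrivial V with hV | hV
  · exact ⟨1, one_pos, fun x => by simp [Subsingleton.elim x 0]⟩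
  obtain ⟨x₀, hx₀, hmin⟩ := (isCompact_sphere (0 : V) 1).exists_isMinOn
    (NormedSpace.sphere_nonempty.2 zero_le_one) (continuous_seminorm p).continuousOn
  have hpos : 0 < p x₀ := by
    refine lt_of_le_of_ne (apply_nonneg p x₀) fun h => ?_
    have := hp x₀ h.symm
    simp [this] at hx₀
  refine ⟨(p x₀)⁻¹, inv_pos.2 hpos, fun x => ?_⟩
  rcases eq_or_ne x 0 with rfl | hx
  · simp
  have hn : 0 < ‖x‖ := norm_pos_iff.2 hx
  have h1 : p x₀ ≤ p (‖x‖⁻¹ • x) := hmin (by simp [norm_smul, hn.ne'])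
  rw [map_smul_eq_mul, norm_inv, norm_norm] at h1
  rw [inv_mul_eq_div, le_div_iff₀ hpos]
  calc ‖x‖ * p x₀ ≤ ‖x‖ * (‖x‖⁻¹ * p x) := by gcongr
    _ = p x := by field_simp

theorem isCompact_seminorm_le_one (p : Seminorm ℝ V) (hp : ∀ x, p x = 0 → x = 0) :
    IsCompact {x | p x ≤ 1} := by
  obtain ⟨c, hc, h⟩ := exists_norm_le_mul_seminorm p hp
  refine (isCompact_closedBall (0 : V) c).of_isClosed_subset
    (isClosed_le (continuous_seminorm p) continuous_const) fun x hx => ?_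
  rw [mem_closedBall_zero_iff]
  exact (h x).trans (mul_le_of_le_one_right hc.le hx)

theorem exists_inner_eq_dualNorm (p : Seminorm ℝ V) (hp : ∀ x, p x = 0 → x = 0) (u : V) :
    ∃ x, p x ≤ 1 ∧ ⟪u, x⟫ = dualNorm p u ∧ ∀ y, p y ≤ 1 → ⟪u, y⟫ ≤ dualNorm p u := by
  obtain ⟨x, hx, hmax⟩ := (isCompact_seminorm_le_one p hp).exists_isMaxOn ⟨0, by simp⟩
    (f := fun x => ⟪u, x⟫) (by fun_prop)
  have hg : IsGreatest {r | ∃ x : V, p x ≤ 1 ∧ r = ⟪u, x⟫} ⟪u, x⟫ :=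
    ⟨⟨x, hx, rfl⟩, by rintro _ ⟨y, hy, rfl⟩; exact hmax hy⟩
  have he : dualNorm p u = ⟪u, x⟫ := hg.csSup_eq
  exact ⟨x, hx, he.symm, fun y hy => he ▸ hmax hy⟩

theorem inner_le_dualNorm_mul (p : Seminorm ℝ V) (hp : ∀ x, p x = 0 → x = 0) (u x : V) :
    ⟪u, x⟫ ≤ dualNorm p u * p x := by
  rcases eq_or_ne x 0 with rfl | hx
  · simp
  have hn : 0 < p x := lt_of_le_of_ne (apply_nonneg p x) fun h => hx (hp x h.symm)
  obtain ⟨_, -, -, h⟩ := exists_inner_eq_dualNorm p hp u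
  have := h ((p x)⁻¹ • x) (by simp [map_smul_eq_mul, abs_of_pos hn, hn.ne'])
  rwa [inner_smul_right, inv_mul_le_iff₀ hn, mul_comm] at this

omit [FiniteDimensional ℝ V] in
theorem dualNorm_le_of_inner_le (p : Seminorm ℝ V) {u : V} {c : ℝ} (hc : 0 ≤ c)
    (h : ∀ x, ⟪u, x⟫ ≤ c * p x) : dualNorm p u ≤ c := by
  refine csSup_le ⟨0, 0, by simp⟩ ?_
  rintro _ ⟨x, hx, rfl⟩
  exact (h x).trans (mul_le_of_le_one_right hc hx)

theorem inner_le_dualNorm_of_le_one (p : Seminorm ℝ V) (hp : ∀ x, p x = 0 → x = 0) (u : V) {x : V}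
    (hx : p x ≤ 1) : ⟪u, x⟫ ≤ dualNorm p u := by
  obtain ⟨_, -, -, h⟩ := exists_inner_eq_dualNorm p hp u
  exact h x hx

end SeminormDuality

/-! ### Sublinearity of the distance to a fiber, and its supporting functionals. -/

section ConeOffset

variable {E F : Type*} [AddCommGroup E] [Module ℝ E] [AddCommGroup F] [Module ℝ F]

/-- The distance, with respect to `p`, from `x` to the fiber `{x' | (x', y) ∈ C}`. -/
noncomputable def fiberDist (p : Seminorm ℝ E) (C : PointedCone ℝ (E × F)) (L : Submodule ℝ F)
    (z : E × L) : ℝ := ⨅ x : {x : E // (x, (z.2 : F)) ∈ C}, p (z.1 - x)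

variable {p : Seminorm ℝ E} {C : PointedCone ℝ (E × F)} {L : Submodule ℝ F}

theorem bddBelow_fiberDist (z : E × L) :
    BddBelow (Set.range fun x : {x : E // (x, (z.2 : F)) ∈ C} => p (z.1 - x)) :=
  ⟨0, by rintro _ ⟨x, rfl⟩; exact apply_nonneg p _⟩

theorem fiberDist_nonneg (z : E × L) : 0 ≤ fiberDist p C L z :=
  Real.iInf_nonneg fun _ => apply_nonneg p _

theorem fiberDist_le {z : E × L} {x : E} (hx : (x, (z.2 : F)) ∈ C) :
    fiberDist p C L z ≤ p (z.1 - x) :=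
  ciInf_le (bddBelow_fiberDist z) (⟨x, hx⟩ : {x : E // (x, (z.2 : F)) ∈ C})

variable (hL : ∀ y ∈ L, ∃ x, (x, y) ∈ C)
include hL

/-- `hL` makes the fibers nonempty; over an empty fiber the real infimum would be 0 by default. -/
theorem exists_lt_of_fiberDist_lt {z : E × L} {r : ℝ} (h : fiberDist p C L z < r) :
    ∃ x, (x, (z.2 : F)) ∈ C ∧ p (z.1 - x) < r := by
  obtain ⟨x, hx⟩ := hL z.2 z.2.2
  have : Nonempty {x : E // (x, (z.2 : F)) ∈ C} := ⟨⟨x, hx⟩⟩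
  obtain ⟨x, hx⟩ := exists_lt_of_ciInf_lt h
  exact ⟨x, x.2, hx⟩

theorem fiberDist_add_le (z w : E × L) :
    fiberDist p C L (z + w) ≤ fiberDist p C L z + fiberDist p C L w := by
  refine le_of_forall_pos_le_add fun ε hε => ?_
  obtain ⟨x, hx, hx'⟩ := exists_lt_of_fiberDist_lt (p := p) hL
    (lt_add_of_pos_right (fiberDist p C L z) (half_pos hε))
  obtain ⟨y, hy, hy'⟩ := exists_lt_of_fiberDist_lt (p := p) hL
    (lt_add_of_pos_right (fiberDist p C L w) (half_pos hε))
  have h1 : fiberDist p C L (z + w) ≤ p ((z + w).1 - (x + y)) := fiberDist_le (C.add_mem hx hy)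
  have h2 : (z + w).1 - (x + y) = (z.1 - x) + (w.1 - y) := by
    rw [Prod.fst_add]; abel
  rw [h2] at h1
  linarith [map_add_le_add p (z.1 - x) (w.1 - y)]

theorem fiberDist_smul_le {c : ℝ} (hc : 0 < c) (z : E × L) :
    fiberDist p C L (c • z) ≤ c * fiberDist p C L z := by
  refine le_of_forall_pos_le_add fun ε hε => ?_
  obtain ⟨x, hx, hx'⟩ := exists_lt_of_fiberDist_lt (p := p) hL
    (lt_add_of_pos_right (fiberDist p C L z) (div_pos hε hc))
  have h1 : fiberDist p C L (c • z) ≤ p ((c • z).1 - c • x) :=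
    fiberDist_le (C.smul_mem hc.le hx)
  rw [Prod.smul_fst, ← smul_sub, map_smul_eq_mul, Real.norm_of_nonneg hc.le] at h1
  calc _ ≤ c * p (z.1 - x) := h1
    _ ≤ c * (fiberDist p C L z + ε / c) := by gcongr
    _ = _ := by field_simp

theorem fiberDist_smul {c : ℝ} (hc : 0 < c) (z : E × L) :
    fiberDist p C L (c • z) = c * fiberDist p C L z := by
  refine le_antisymm (fiberDist_smul_le hL hc z) ?_
  have := fiberDist_smul_le (p := p) hL (inv_pos.2 hc) (c • z)
  rwa [inv_smul_smul₀ hc.ne', le_inv_mul_iff₀ hc] at this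

theorem fiberDist_smul_of_nonneg {c : ℝ} (hc : 0 ≤ c) (z : E × L) :
    fiberDist p C L (c • z) = c * fiberDist p C L z := by
  rcases hc.eq_or_lt with rfl | hc
  · have h : fiberDist p C L (0 : E × L) ≤ p ((0 : E × L).1 - 0) := fiberDist_le C.zero_mem
    have h0 : fiberDist p C L (0 : E × L) = 0 :=
      le_antisymm (by simpa using h) (fiberDist_nonneg _)
    rw [zero_smul, zero_mul, h0]
  · exact fiberDist_smul hL hc z

theorem convexOn_fiberDist : ConvexOn ℝ Set.univ (fiberDist p C L) := by
  refine ⟨convex_univ, fun z _ w _ a b ha hb _ => ?_⟩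
  simp only [smul_eq_mul]
  rw [← fiberDist_smul_of_nonneg hL ha, ← fiberDist_smul_of_nonneg hL hb]
  exact fiberDist_add_le hL _ _

theorem exists_linearMap_le_fiberDist (z₀ : E × L) :
    ∃ g : E × L →ₗ[ℝ] ℝ, g z₀ = fiberDist p C L z₀ ∧ ∀ z, g z ≤ fiberDist p C L z := by
  have hz : ∀ c : ℝ, c • z₀ = 0 → c • fiberDist p C L z₀ = 0 := by
    intro c hc
    rcases smul_eq_zero.1 hc with rfl | h
    · simp
    · have := fiberDist_smul_of_nonneg (p := p) hL le_rfl z₀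
      rw [zero_smul, zero_mul] at this
      rw [h, this, smul_zero]
  obtain ⟨g, hg, hle⟩ := exists_extension_of_le_sublinear
    (LinearPMap.mkSpanSingleton' (σ := RingHom.id ℝ) z₀ (fiberDist p C L z₀) hz)
    (fiberDist p C L) (fun c hc z => fiberDist_smul hL hc z) (fiberDist_add_le hL) (by
      rintro ⟨z, hmem⟩
      obtain ⟨c, rfl⟩ := Submodule.mem_span_singleton.1 hmem
      rw [LinearPMap.mkSpanSingleton'_apply]
      -- On the negative half-line the prescribed value is nonpositive, while `fiberDist` is
      -- nonnegative.
      rcases le_total 0 c with hc | hc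
      · exact (fiberDist_smul_of_nonneg hL hc z₀).ge
      · exact (mul_nonpos_of_nonpos_of_nonneg hc (fiberDist_nonneg z₀)).trans
          (fiberDist_nonneg _))
  refine ⟨g, ?_, hle⟩
  have hmem : z₀ ∈ (LinearPMap.mkSpanSingleton' (σ := RingHom.id ℝ) z₀
      (fiberDist p C L z₀) hz).domain := Submodule.mem_span_singleton_self z₀
  rw [hg ⟨z₀, hmem⟩, LinearPMap.mkSpanSingleton'_apply_self]

end ConeOffset

/-! ### Weak and strong duality for one cone. -/

section ConeDuality

variable {E F : Type*} [NormedAddCommGroup E] [InnerProductSpace ℝ E] [FiniteDimensional ℝ E]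
  [NormedAddCommGroup F] [InnerProductSpace ℝ F] [FiniteDimensional ℝ F]
  (p : Seminorm ℝ E) (q : Seminorm ℝ F) (C : PointedCone ℝ (E × F))

omit [FiniteDimensional ℝ E] [FiniteDimensional ℝ F] in
theorem exists_mem_of_mem_span_im (hC : IsRelSurjective (ofGraph (C : Set (E × F)))) :
    ∀ y ∈ Submodule.span ℝ (im (ofGraph (C : Set (E × F)))), ∃ x, (x, y) ∈ C := by
  obtain ⟨L, hL⟩ := hC
  rw [← hL, Submodule.span_eq]
  intro y hy
  have : y ∈ im (ofGraph (C : Set (E × F))) := hL ▸ hy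
  exact this

/-- A finite convex function in finite dimension is continuous, so the outer supremum is attained on
the compact unit ball of `L`. The inner infimum need not be attained. -/
theorem exists_invNorm_eq_fiberDist (hq : ∀ y, q y = 0 → y = 0)
    (hC : IsRelSurjective (ofGraph (C : Set (E × F)))) :
    ∃ y₀ : Submodule.span ℝ (im (ofGraph (C : Set (E × F)))), q y₀ ≤ 1 ∧
      invNorm p q (ofGraph (C : Set (E × F))) = ENNReal.ofReal (fiberDist p C _ (0, y₀)) ∧
      ∀ y : Submodule.span ℝ (im (ofGraph (C : Set (E × F)))), q y ≤ 1 →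
        fiberDist p C _ (0, y) ≤ fiberDist p C _ (0, y₀) := by
  set L := Submodule.span ℝ (im (ofGraph (C : Set (E × F)))) with hLdef
  have hL : ∀ y ∈ L, ∃ x, (x, y) ∈ C := exists_mem_of_mem_span_im C hC
  have hcont : Continuous fun y : L => fiberDist p C L (0, y) :=
    (convexOn_fiberDist hL).locallyLipschitz.continuous.comp (by fun_prop)
  obtain ⟨y₀, hy₀, hmax⟩ := (isCompact_seminorm_le_one (q.comp L.subtype)
    fun y hy => Subtype.ext (hq y hy)).exists_isMaxOn ⟨0, by simp⟩ hcont.continuousOn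
  have hval : ∀ y : L, ⨅ x ∈ inv (ofGraph (C : Set (E × F))) y, ENNReal.ofReal (p x) =
      ENNReal.ofReal (fiberDist p C L (0, y)) := by
    intro y
    obtain ⟨x, hx⟩ := hL y y.2
    have : Nonempty {x : E // (x, (y : F)) ∈ C} := ⟨⟨x, hx⟩⟩
    rw [fiberDist, ENNReal.ofReal_iInf, iInf_subtype']
    simp only [zero_sub, map_neg_eq_map]
    rfl
  refine ⟨y₀, hy₀, le_antisymm ?_ ?_, fun y hy => hmax hy⟩
  · refine iSup₂_le fun y hy => ?_
    obtain ⟨⟨x, hx⟩, hy1⟩ := hy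
    have hyL : y ∈ L := Submodule.subset_span ⟨x, hx⟩
    rw [hval ⟨y, hyL⟩]
    exact ENNReal.ofReal_le_ofReal (hmax (show q y ≤ 1 from hy1))
  · rw [← hval y₀]
    obtain ⟨x, hx⟩ := hL y₀ y₀.2
    exact le_iSup₂ (f := fun (y : F) (_ : y ∈ {y | y ∈ dom (inv (ofGraph (C : Set (E × F)))) ∧
      q y ≤ 1}) => ⨅ x ∈ inv (ofGraph (C : Set (E × F))) y, ENNReal.ofReal (p x))
      (y₀ : F) ⟨⟨x, hx⟩, hy₀⟩

variable {p q C}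

theorem one_le_dualNorm_mul_fiberDist (hp : ∀ x, p x = 0 → x = 0) (hq : ∀ y, q y = 0 → y = 0)
    (hC : IsRelSurjective (ofGraph (C : Set (E × F)))) {h : ℝ}
    (hh : ∀ y : Submodule.span ℝ (im (ofGraph (C : Set (E × F)))), q y ≤ 1 →
        fiberDist p C _ (0, y) ≤ h) {w : E × F}
    (hw : w ∈ dualFeasible q (ofGraph (C : Set (E × F)))) : 1 ≤ dualNorm p w.1 * h := by
  obtain ⟨hu, hv⟩ := hw
  set L := Submodule.span ℝ (im (ofGraph (C : Set (E × F)))) with hLdef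
  have hL : ∀ y ∈ L, ∃ x, (x, y) ∈ C := exists_mem_of_mem_span_im C hC
  obtain ⟨y, hy, hy', -⟩ := exists_inner_eq_dualNorm (q.comp L.subtype)
    (fun y hy => Subtype.ext (hq y hy)) (L.orthogonalProjectionOnto w.2)
  have hone : ⟪L.orthogonalProjectionOnto w.2, y⟫ = 1 := hy'.trans hv
  rw [L.inner_orthogonalProjectionOnto_eq_of_mem_right] at hone
  -- Since `⟪v, y⟫ = 1`, every `x` in the fiber over `-y` satisfies `⟪u, x⟫ ≤ -1`, so `1 ≤ ‖u‖* p
  -- (-x)`.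
  have hneg : q ((-y : L) : F) ≤ 1 := by simpa using hy
  have hpos : 0 ≤ dualNorm p w.1 := by
    simpa using inner_le_dualNorm_of_le_one p hp w.1 (x := 0) (by simp)
  refine le_of_forall_pos_le_add fun ε hε => ?_
  -- The `+ 1` covers the case `‖u‖* = 0`.
  have hd : 0 < ε / (dualNorm p w.1 + 1) := by positivity
  obtain ⟨x, hx, hx'⟩ := exists_lt_of_fiberDist_lt (p := p) hL
    (lt_add_of_pos_right (fiberDist p C L (0, -y)) hd)
  have h1 : ⟪w.1, x⟫ ≤ ⟪w.2, ((-y : L) : F)⟫ := hu _ hx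
  rw [Submodule.coe_neg, inner_neg_right, hone] at h1
  have h2 := inner_le_dualNorm_mul p hp w.1 (0 - x)
  rw [zero_sub, inner_neg_right] at h2
  have h3 : p (-x) ≤ h + ε / (dualNorm p w.1 + 1) := by
    have := hh (-y) hneg
    simp only [zero_sub] at hx'
    linarith
  calc 1 ≤ dualNorm p w.1 * p (-x) := by linarith
    _ ≤ dualNorm p w.1 * (h + ε / (dualNorm p w.1 + 1)) := by gcongr
    _ = dualNorm p w.1 * h + ε * (dualNorm p w.1 / (dualNorm p w.1 + 1)) := by ring
    _ ≤ dualNorm p w.1 * h + ε * 1 := by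
        gcongr
        exact (div_le_one (by positivity)).2 (by linarith)
    _ = _ := by ring

omit [NormedAddCommGroup E] [InnerProductSpace ℝ E] [FiniteDimensional ℝ E] in
theorem projDualNorm_coe (q : Seminorm ℝ F) (Φ : E → Set F) (v : Submodule.span ℝ (im Φ)) :
    projDualNorm q Φ v = dualNorm (q.comp (Submodule.span ℝ (im Φ)).subtype) v :=
  congrArg (dualNorm (q.comp (Submodule.span ℝ (im Φ)).subtype))
    (Submodule.orthogonalProjectionOnto_mem_subspace_eq_self v)

/-- For the supporting functional `g` at `(0, y₀)`: `g ≤ 0` on `C` gives `u ∈ Φ*(v)`, `g (x, 0) ≤ p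
x` bounds `‖u‖*`, and maximality of `y₀` makes the dual norm of `v` equal to 1, attained at `-y₀`.
-/
theorem exists_dualFeasible_dualNorm_le (hq : ∀ y, q y = 0 → y = 0)
    (hC : IsRelSurjective (ofGraph (C : Set (E × F))))
    {L : Submodule ℝ F} (hLdef : L = Submodule.span ℝ (im (ofGraph (C : Set (E × F)))))
    {y₀ : L} (hy₀ : q y₀ ≤ 1)
    (hmax : ∀ y : L, q y ≤ 1 → fiberDist p C L (0, y) ≤ fiberDist p C L (0, y₀))
    (hpos : 0 < fiberDist p C L (0, y₀)) :
    ∃ w ∈ dualFeasible q (ofGraph (C : Set (E × F))),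
      dualNorm p w.1 ≤ (fiberDist p C L (0, y₀))⁻¹ := by
  have hL : ∀ y ∈ L, ∃ x, (x, y) ∈ C := hLdef ▸ exists_mem_of_mem_span_im C hC
  have hqL : ∀ y : L, q.comp L.subtype y = 0 → y = 0 := fun y hy => Subtype.ext (hq y hy)
  set h := fiberDist p C L (0, y₀) with hh
  obtain ⟨g, hg₀, hg⟩ := exists_linearMap_le_fiberDist (p := p) hL ((0 : E), y₀)
  have hgC : ∀ x (y : L), (x, (y : F)) ∈ C → g (x, y) ≤ 0 := by
    intro x y hxy
    have := fiberDist_le (p := p) (z := (x, y)) hxy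
    simp only [sub_self, map_zero] at this
    exact (hg _).trans this
  have hgE : ∀ x, g (x, 0) ≤ p x := by
    intro x
    have := fiberDist_le (p := p) (z := (x, (0 : L))) (x := 0) C.zero_mem
    rw [sub_zero] at this
    exact (hg _).trans this
  let ℓ : StrongDual ℝ E := LinearMap.toContinuousLinearMap (g ∘ₗ LinearMap.inl ℝ E L)
  let m : StrongDual ℝ L := LinearMap.toContinuousLinearMap (g ∘ₗ LinearMap.inr ℝ E L)
  let u : E := h⁻¹ • (InnerProductSpace.toDual ℝ E).symm ℓ
  let v : L := -(h⁻¹ • (InnerProductSpace.toDual ℝ L).symm m)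
  have hu : ∀ x, ⟪u, x⟫ = h⁻¹ * g (x, 0) := by
    intro x
    rw [real_inner_smul_left, InnerProductSpace.toDual_symm_apply]
    rfl
  have hv : ∀ y, ⟪v, y⟫ = -(h⁻¹ * g (0, y)) := by
    intro y
    rw [inner_neg_left, real_inner_smul_left, InnerProductSpace.toDual_symm_apply]
    rfl
  have hi : 0 < h⁻¹ := inv_pos.2 hpos
  refine ⟨(u, (v : F)), ⟨?_, ?_⟩, ?_⟩
  · rintro ⟨x, y⟩ hxy
    have hyL : y ∈ L := hLdef ▸ Submodule.subset_span ⟨x, hxy⟩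
    have h1 := hgC x ⟨y, hyL⟩ hxy
    have h2 : (⟪(v : F), y⟫ : ℝ) = -(h⁻¹ * g (0, ⟨y, hyL⟩)) := hv ⟨y, hyL⟩
    have h3 : g (x, ⟨y, hyL⟩) = g (x, 0) + g (0, ⟨y, hyL⟩) := by
      rw [← map_add]; simp
    simp only
    rw [hu, h2]
    nlinarith
  · have hqv : projDualNorm q (ofGraph (C : Set (E × F))) v = dualNorm (q.comp L.subtype) v := by
      subst hLdef
      exact projDualNorm_coe q _ v
    have hm : ∀ y : L, q y ≤ 1 → -g (0, y) ≤ h := by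
      intro y hy
      have h1 := hmax (-y) (by simpa using hy)
      have h2 := hg (0, -y)
      have h3 : g (0, -y) = -g (0, y) := by rw [← map_neg]; simp
      linarith
    rw [hqv]
    refine le_antisymm ?_ ?_
    · refine csSup_le ⟨0, 0, by simp⟩ ?_
      rintro _ ⟨y, hy, rfl⟩
      rw [hv]
      have := mul_le_mul_of_nonneg_left (hm y hy) hi.le
      rw [inv_mul_cancel₀ hpos.ne'] at this
      linarith
    · have h1 := inner_le_dualNorm_of_le_one (q.comp L.subtype) hqL v (x := -y₀)
        (by simpa using hy₀)
      rw [inner_neg_right, hv, neg_neg, hg₀, inv_mul_cancel₀ hpos.ne'] at h1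
      exact h1
  · refine dualNorm_le_of_inner_le p hi.le fun x => ?_
    rw [hu]
    exact mul_le_mul_of_nonneg_left (hgE x) hi.le

/-- Duality for a pointed cone whose image is a linear subspace. -/
theorem invNorm_eq_one_div_dualMin (hp : ∀ x, p x = 0 → x = 0) (hq : ∀ y, q y = 0 → y = 0)
    (hC : IsRelSurjective (ofGraph (C : Set (E × F)))) :
    invNorm p q (ofGraph (C : Set (E × F))) ≠ ⊤ ∧
    invNorm p q (ofGraph (C : Set (E × F))) = 1 / dualMin p q (ofGraph (C : Set (E × F))) ∧
    DualMinAttained p q (ofGraph (C : Set (E × F))) := by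
  obtain ⟨y₀, hy₀, hinv, hmax⟩ := exists_invNorm_eq_fiberDist p q C hq hC
  have hlow : ∀ w ∈ dualFeasible q (ofGraph (C : Set (E × F))),
      1 ≤ dualNorm p w.1 * fiberDist p C _ (0, y₀) :=
    fun w hw => one_le_dualNorm_mul_fiberDist hp hq hC hmax hw
  refine ⟨hinv ▸ ENNReal.ofReal_ne_top, ?_⟩
  rw [hinv]
  -- If the maximum is 0, a feasible pair would give `1 ≤ 0`; the minimum is then `⊤` and both sides
  -- vanish.
  rcases (fiberDist_nonneg (p := p) (C := C) (0, y₀)).eq_or_lt with h0 | hpos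
  · have hempty : dualFeasible q (ofGraph (C : Set (E × F))) = ∅ := by
      refine Set.eq_empty_of_forall_notMem fun w hw => ?_
      have := hlow w hw
      rw [← h0, mul_zero] at this
      exact absurd this (by norm_num)
    refine ⟨?_, fun hne => ?_⟩
    · rw [← h0, dualMin, hempty]
      simp
    · rw [hempty] at hne
      exact absurd hne Set.not_nonempty_empty
  · obtain ⟨w, hw, hle⟩ := exists_dualFeasible_dualNorm_le hq hC rfl hy₀ hmax hpos
    have hge : ∀ w' ∈ dualFeasible q (ofGraph (C : Set (E × F))),
        (fiberDist p C _ (0, y₀))⁻¹ ≤ dualNorm p w'.1 := fun w' hw' => by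
      rw [inv_le_iff_one_le_mul₀ hpos]
      exact hlow w' hw'
    refine ⟨?_, fun _ => ⟨w, hw, fun w' hw' => hle.trans (hge w' hw')⟩⟩
    have hmin : dualMin p q (ofGraph (C : Set (E × F))) =
        ENNReal.ofReal (fiberDist p C _ (0, y₀))⁻¹ := by
      refine le_antisymm ((iInf₂_le w hw).trans (ENNReal.ofReal_le_ofReal hle)) ?_
      exact le_iInf₂ fun w' hw' => ENNReal.ofReal_le_ofReal (hge w' hw')
    rw [hmin, ENNReal.ofReal_inv_of_pos hpos, one_div, inv_inv]

end ConeDuality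

/-! ### Tangent cones to polyhedra. -/

section TangentCones

variable {V : Type*} [AddCommGroup V] [Module ℝ V]

theorem IsPolyhedron.convex {Q : Set V} (hQ : IsPolyhedron Q) : Convex ℝ Q := by
  obtain ⟨k, f, b, rfl⟩ := hQ
  rw [Set.ofPred_forall]
  exact convex_iInter fun i => convex_halfSpace_le (f i).isLinear (b i)

/-- The tangent cone to a convex set, as a pointed cone. -/
theorem exists_pointedCone_eq_tangentCone {Q : Set V} (hQ : Convex ℝ Q) {z : V} (hz : z ∈ Q) :
    ∃ C : PointedCone ℝ V, (C : Set V) = tangentCone Q z := by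
  have hsmul : ∀ c : ℝ, 0 ≤ c → ∀ d ∈ tangentCone Q z, c • d ∈ tangentCone Q z := by
    rintro c hc d ⟨t, ht, hd⟩
    rcases hc.eq_or_lt with rfl | hc
    · exact ⟨1, one_pos, by simpa using hz⟩
    · exact ⟨t / c, by positivity, by rwa [smul_smul, div_mul_cancel₀ _ hc.ne']⟩
  refine ⟨{ carrier := tangentCone Q z, add_mem' := ?_, zero_mem' := ?_, smul_mem' := ?_ }, rfl⟩
  · rintro d e ⟨s, hs, hd⟩ ⟨t, ht, he⟩
    refine ⟨s * t / (s + t), by positivity, ?_⟩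
    have := hQ hd he (a := t / (s + t)) (b := s / (s + t)) (by positivity) (by positivity)
      (by field_simp; ring)
    convert this using 1
    have h1 : (t / (s + t)) • z + (s / (s + t)) • z = z := by
      rw [← add_smul, ← add_div, add_comm t s, div_self (by positivity), one_smul]
    have e1 : t / (s + t) * s = s * t / (s + t) := by ring
    have e2 : s / (s + t) * t = s * t / (s + t) := by ring
    rw [smul_add (t / (s + t)), smul_add (s / (s + t)), smul_smul, smul_smul, e1, e2, smul_add]
    nth_rewrite 1 [← h1]
    abel
  · exact ⟨1, one_pos, by simpa using hz⟩
  · exact fun c d hd => hsmul c c.2 d hd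

theorem sub_mem_tangentCone {Q : Set V} {z w : V} (hw : w ∈ Q) : w - z ∈ tangentCone Q z :=
  ⟨1, one_pos, by simpa using hw⟩

/-- Inactive constraints stay satisfied for small `t`, so only the active index set matters; this
yields finiteness of `tangentCones`. -/
theorem tangentCone_eq_of_polyhedron {k : ℕ} (f : Fin k → V →ₗ[ℝ] ℝ) (b : Fin k → ℝ) {z : V}
    (hz : ∀ i, f i z ≤ b i) :
    tangentCone {z | ∀ i, f i z ≤ b i} z = {d | ∀ i ∈ {i | f i z = b i}, f i d ≤ 0} := by
  ext d
  constructor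
  · rintro ⟨t, ht, h⟩ i hi
    have h1 := h i
    rw [map_add, map_smul, smul_eq_mul, show f i z = b i from hi] at h1
    exact nonpos_of_mul_nonpos_right (by linarith) ht
  · intro hd
    have hev : ∀ i, ∀ᶠ t : ℝ in nhdsWithin 0 (Set.Ioi 0), f i (z + t • d) ≤ b i := by
      intro i
      rcases (hz i).eq_or_lt with hi | hi
      · filter_upwards [self_mem_nhdsWithin] with t ht
        rw [map_add, map_smul, smul_eq_mul, hi]
        linarith [mul_nonpos_of_nonneg_of_nonpos (le_of_lt (Set.mem_Ioi.1 ht)) (hd i hi)]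
      · have hc : Continuous fun t : ℝ => f i z + t * f i d := by fun_prop
        have hlt := (hc.tendsto 0).eventually (eventually_lt_nhds (b := b i) (by simpa using hi))
        filter_upwards [nhdsWithin_le_nhds hlt] with t ht
        rw [map_add, map_smul, smul_eq_mul]
        exact le_of_lt ht
    obtain ⟨t, ht, ht0⟩ := ((Filter.eventually_all.2 hev).and self_mem_nhdsWithin).exists
    exact ⟨t, ht0, ht⟩

theorem IsPolyhedron.finite_tangentCones {Q : Set V} (hQ : IsPolyhedron Q) :
    (tangentCones Q).Finite := by
  obtain ⟨k, f, b, rfl⟩ := hQ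
  refine (Set.finite_range fun I : Set (Fin k) => {d | ∀ i ∈ I, f i d ≤ 0}).subset ?_
  rintro _ ⟨z, hz, rfl⟩
  exact ⟨{i | f i z = b i}, (tangentCone_eq_of_polyhedron f b hz).symm⟩

/-- Some tangent cone to a nonempty polyhedron is a linear subspace. -/
theorem IsPolyhedron.exists_submodule_mem_tangentCones {Q : Set V} (hQ : IsPolyhedron Q)
    (hne : Q.Nonempty) : ∃ L : Submodule ℝ V, (L : Set V) ∈ tangentCones Q := by
  obtain ⟨z₀, hz₀⟩ := hne
  -- A maximal tangent cone is a subspace: moving from `z` to the midpoint `m` of `z` and `z + t •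
  -- d` can only enlarge the cone, so by maximality it already contains `z - m`, a positive multiple
  -- of `-d`.
  obtain ⟨T, ⟨⟨z, hz, rfl⟩, hmax⟩⟩ :=
    hQ.finite_tangentCones.exists_maximal ⟨_, z₀, hz₀, rfl⟩
  obtain ⟨C, hC⟩ := exists_pointedCone_eq_tangentCone hQ.convex hz
  have hneg : ∀ d ∈ C, -d ∈ C := by
    intro d hd
    have hd' : d ∈ tangentCone Q z := hC ▸ hd
    obtain ⟨t, ht, hw⟩ := hd'
    have hmid := hQ.convex hz hw (a := 1 / 2) (b := 1 / 2) (by norm_num) (by norm_num)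
      (by norm_num)
    set m := (1 / 2 : ℝ) • z + (1 / 2 : ℝ) • (z + t • d) with hm
    have hle : tangentCone Q z ≤ tangentCone Q m := by
      rintro e ⟨s, hs, he⟩
      refine ⟨s / 2, by positivity, ?_⟩
      have := hQ.convex he hw (a := 1 / 2) (b := 1 / 2) (by norm_num) (by norm_num) (by norm_num)
      convert this using 1
      rw [hm]
      module
    have hzm : z - m ∈ C := by
      have : z - m ∈ tangentCone Q z := hmax ⟨m, hmid, rfl⟩ hle (sub_mem_tangentCone hz)
      rwa [← hC] at this
    have h2 : (2 / t) • (z - m) = -d := by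
      have : z - m = (-(t / 2)) • d := by rw [hm]; module
      rw [this, smul_smul, show 2 / t * -(t / 2) = -1 by field_simp, neg_one_smul]
    rw [← h2]
    exact C.smul_mem (by positivity) hzm
  refine ⟨{ carrier := C, add_mem' := C.add_mem, zero_mem' := C.zero_mem, smul_mem' := ?_ },
    z, hz, hC⟩
  intro c d hd
  rcases le_total 0 c with hc | hc
  · exact C.smul_mem hc hd
  · have := C.smul_mem (neg_nonneg.2 hc) (hneg d hd)
    rwa [neg_smul_neg] at this

/-- `T_Q(z') ⊆ T_Q(z) - ℝ₊ w` with `w = z' - z`. -/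
theorem add_smul_sub_mem_tangentCone {Q : Set V} {z z' d : V}
    (hd : d ∈ tangentCone Q z') : ∃ s : ℝ, 0 < s ∧ d + s • (z' - z) ∈ tangentCone Q z := by
  obtain ⟨t, ht, h⟩ := hd
  refine ⟨t⁻¹, by positivity, t, ht, ?_⟩
  convert h using 1
  rw [smul_add, smul_smul, mul_inv_cancel₀ ht.ne', one_smul]
  abel

theorem tangentCone_zero_eq {Q : Set V} (hQ : ∀ c : ℝ, 0 < c → ∀ z ∈ Q, c • z ∈ Q) :
    tangentCone Q 0 = Q := by
  ext d
  constructor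
  · rintro ⟨t, ht, h⟩
    rw [zero_add] at h
    simpa [smul_smul, ht.ne'] using hQ t⁻¹ (by positivity) _ h
  · exact fun hd => ⟨1, one_pos, by simpa using hd⟩

/-- A `ConvexCone` may omit 0; here closedness supplies it, as the limit of `t • z` for `t → 0⁺`. -/
theorem IsPolyhedron.zero_mem {Q : Set V} (hP : IsPolyhedron Q) (hne : Q.Nonempty)
    (hQ : ∀ c : ℝ, 0 < c → ∀ z ∈ Q, c • z ∈ Q) : (0 : V) ∈ Q := by
  obtain ⟨k, f, b, rfl⟩ := hP
  obtain ⟨z, hz⟩ := hne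
  intro i
  have hc : Continuous fun t : ℝ => t * f i z := by fun_prop
  have hlim : Filter.Tendsto (fun t : ℝ => t * f i z) (nhdsWithin 0 (Set.Ioi 0)) (nhds 0) := by
    simpa using (hc.tendsto 0).mono_left nhdsWithin_le_nhds
  rw [map_zero]
  refine le_of_tendsto hlim ?_
  filter_upwards [self_mem_nhdsWithin] with t ht
  simpa using hQ t ht z hz i

end TangentCones

/-! ### Comparison of tangent cones and reduction to a covering family. -/

section Hoffman

variable {E F : Type*} [AddCommGroup E] [Module ℝ E] [AddCommGroup F] [Module ℝ F]

omit [AddCommGroup E] [Module ℝ E] [AddCommGroup F] [Module ℝ F] in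
theorem im_ofGraph_mono {S T : Set (E × F)} (h : S ⊆ T) : im (ofGraph S) ⊆ im (ofGraph T) :=
  fun _ ⟨x, hx⟩ => ⟨x, h hx⟩

/-- A larger tangent cone has the same image, if the image of the smaller one is a subspace. -/
theorem im_ofGraph_eq_of_subset {Q : Set (E × F)} {S T : Set (E × F)}
    (hS : S ∈ tangentCones Q) (hT : T ∈ tangentCones Q) (hST : S ⊆ T)
    (hr : IsRelSurjective (ofGraph S)) : im (ofGraph T) = im (ofGraph S) := by
  refine Set.Subset.antisymm ?_ (im_ofGraph_mono hST)
  obtain ⟨z, hz, rfl⟩ := hS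
  obtain ⟨z', hz', rfl⟩ := hT
  obtain ⟨L, hL⟩ := hr
  rintro y ⟨x, hxy⟩
  obtain ⟨s, hs, h⟩ := add_smul_sub_mem_tangentCone (z := z) hxy
  have h1 : y + s • (z' - z).2 ∈ L := by
    rw [← SetLike.mem_coe, hL]; exact ⟨_, h⟩
  have h2 : (z' - z).2 ∈ L := by
    rw [← SetLike.mem_coe, hL]; exact ⟨(z' - z).1, sub_mem_tangentCone hz'⟩
  rw [← hL, SetLike.mem_coe]
  simpa using L.sub_mem h1 (L.smul_mem s h2)

/-- Larger fibers lower the infimum, and equal images keep the supremum over the same set. -/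
theorem invNorm_anti (p : Seminorm ℝ E) (q : Seminorm ℝ F) {S T : Set (E × F)} (hST : S ⊆ T)
    (him : im (ofGraph T) = im (ofGraph S)) :
    invNorm p q (ofGraph T) ≤ invNorm p q (ofGraph S) := by
  refine iSup₂_le fun y hy => ?_
  obtain ⟨hyT, hy1⟩ := hy
  have hyS : y ∈ im (ofGraph S) := him ▸ hyT
  refine le_trans (le_iInf₂ fun x hx => ?_)
    (le_iSup₂ (f := fun (y : F) (_ : y ∈ {y | y ∈ dom (inv (ofGraph S)) ∧ q y ≤ 1}) =>
      ⨅ x ∈ inv (ofGraph S) y, ENNReal.ofReal (p x)) y ⟨hyS, hy1⟩)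
  exact iInf₂_le x (hST hx)

/-- This forces `𝔉` to be nonempty, so that the maximum over it exists. -/
theorem relSurjCones_nonempty {Φ : E → Set F} (hΦ : IsPolyhedral Φ) (hne : (graph Φ).Nonempty) :
    (relSurjCones Φ).Nonempty := by
  obtain ⟨L, hL⟩ := IsPolyhedron.exists_submodule_mem_tangentCones hΦ hne
  refine ⟨L, hL, L.map (LinearMap.snd ℝ E F), ?_⟩
  ext y
  constructor
  · rintro ⟨⟨x, y⟩, h, rfl⟩
    exact ⟨x, h⟩
  · rintro ⟨x, h⟩
    exact ⟨(x, y), h, rfl⟩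

theorem exists_subset_of_mem_relSurjCones {Φ : E → Set F} {𝔉 𝔍 : Set (Set (E × F))}
    (hJ : 𝔍 ⊆ tangentCones (graph Φ) \ relSurjCones Φ)
    (hcov : ∀ T ∈ tangentCones (graph Φ), (∃ K ∈ 𝔉, K ⊆ T) ∨ ∃ I ∈ 𝔍, T ⊆ I)
    {T : Set (E × F)} (hT : T ∈ relSurjCones Φ) : ∃ K ∈ 𝔉, K ⊆ T := by
  refine (hcov T hT.1).resolve_right ?_
  rintro ⟨I, hI, hTI⟩
  obtain ⟨L, hL⟩ := hT.2
  exact (hJ hI).2 ⟨(hJ hI).1, L,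
    hL.trans (im_ofGraph_eq_of_subset hT.1 (hJ hI).1 hTI hT.2).symm⟩

/-- The Hoffman constant is attained on a family that covers all tangent cones. -/
theorem isGreatest_hoffman (p : Seminorm ℝ E) (q : Seminorm ℝ F) {Φ : E → Set F}
    (hΦ : IsPolyhedral Φ) (hne : (graph Φ).Nonempty) {𝔉 𝔍 : Set (Set (E × F))}
    (hF : 𝔉 ⊆ relSurjCones Φ) (hJ : 𝔍 ⊆ tangentCones (graph Φ) \ relSurjCones Φ)
    (hcov : ∀ T ∈ tangentCones (graph Φ), (∃ K ∈ 𝔉, K ⊆ T) ∨ ∃ I ∈ 𝔍, T ⊆ I) :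
    IsGreatest ((fun T => invNorm p q (ofGraph T)) '' 𝔉) (hoffman p q Φ) := by
  obtain ⟨T₀, hT₀⟩ := relSurjCones_nonempty hΦ hne
  obtain ⟨K₀, hK₀, -⟩ := exists_subset_of_mem_relSurjCones hJ hcov hT₀
  have hfin : 𝔉.Finite := (IsPolyhedron.finite_tangentCones hΦ).subset fun T hT => (hF hT).1
  obtain ⟨K, hK, hmax⟩ := hfin.exists_maximalFor (fun T => invNorm p q (ofGraph T)) 𝔉 ⟨K₀, hK₀⟩
  have hmax' : ∀ T ∈ 𝔉, invNorm p q (ofGraph T) ≤ invNorm p q (ofGraph K) := fun T hT =>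
    (le_total _ _).elim id fun h => hmax hT h
  have heq : hoffman p q Φ = invNorm p q (ofGraph K) := by
    refine le_antisymm (iSup₂_le fun T hT => ?_)
      (le_iSup₂ (f := fun (T : Set (E × F)) (_ : T ∈ relSurjCones Φ) =>
        invNorm p q (ofGraph T)) K (hF hK))
    obtain ⟨K', hK', hsub⟩ := exists_subset_of_mem_relSurjCones hJ hcov hT
    exact (invNorm_anti p q hsub
      (im_ofGraph_eq_of_subset (hF hK').1 hT.1 hsub (hF hK').2)).trans (hmax' K' hK')
  rw [heq]
  exact ⟨⟨K, hK, rfl⟩, by rintro _ ⟨T, hT, rfl⟩; exact hmax' T hT⟩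

end Hoffman

end SetMap

/-! ### The two parts of the theorem. -/

theorem SetMap.hoffman_of_cover {E F : Type*}
    [NormedAddCommGroup E] [InnerProductSpace ℝ E] [FiniteDimensional ℝ E]
    [NormedAddCommGroup F] [InnerProductSpace ℝ F] [FiniteDimensional ℝ F]
    (p : Seminorm ℝ E) (hp : ∀ x, p x = 0 → x = 0)
    (q : Seminorm ℝ F) (hq : ∀ y, q y = 0 → y = 0)
    (Φ : E → Set F) (hΦ : SetMap.IsPolyhedral Φ) (hne : (SetMap.graph Φ).Nonempty)
    {𝔉 𝔍 : Set (Set (E × F))} (hF : 𝔉 ⊆ SetMap.relSurjCones Φ)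
    (hJ : 𝔍 ⊆ SetMap.tangentCones (SetMap.graph Φ) \ SetMap.relSurjCones Φ)
    (hcov : ∀ T ∈ SetMap.tangentCones (SetMap.graph Φ), (∃ K ∈ 𝔉, K ⊆ T) ∨ ∃ I ∈ 𝔍, T ⊆ I) :
    SetMap.hoffman p q Φ ≠ ⊤ ∧
      IsGreatest ((fun T => SetMap.invNorm p q (SetMap.ofGraph T)) '' 𝔉)
        (SetMap.hoffman p q Φ) ∧
      IsGreatest ((fun T => 1 / SetMap.dualMin p q (SetMap.ofGraph T)) '' 𝔉)
        (SetMap.hoffman p q Φ) ∧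
      ∀ T ∈ 𝔉, SetMap.DualMinAttained p q (SetMap.ofGraph T) := by
  have hdual : ∀ T ∈ 𝔉, SetMap.invNorm p q (SetMap.ofGraph T) ≠ ⊤ ∧
      SetMap.invNorm p q (SetMap.ofGraph T) = 1 / SetMap.dualMin p q (SetMap.ofGraph T) ∧
      SetMap.DualMinAttained p q (SetMap.ofGraph T) := by
    intro T hT
    obtain ⟨⟨z, hz, rfl⟩, hr⟩ := hF hT
    obtain ⟨C, hC⟩ := SetMap.exists_pointedCone_eq_tangentCone
      (SetMap.IsPolyhedron.convex hΦ) hz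
    rw [← hC] at hr ⊢
    exact SetMap.invNorm_eq_one_div_dualMin hp hq hr
  have hg := SetMap.isGreatest_hoffman p q hΦ hne hF hJ hcov
  refine ⟨?_, hg, ?_, fun T hT => (hdual T hT).2.2⟩
  · obtain ⟨T, hT, h⟩ := hg.1
    exact h ▸ (hdual T hT).1
  · rwa [← Set.image_congr fun T hT => (hdual T hT).2.1]

theorem mainTheorem10 {E F : Type*}
    [NormedAddCommGroup E] [InnerProductSpace ℝ E] [FiniteDimensional ℝ E]
    [NormedAddCommGroup F] [InnerProductSpace ℝ F] [FiniteDimensional ℝ F]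
    (p : Seminorm ℝ E) (hp : ∀ x, p x = 0 → x = 0)
    (q : Seminorm ℝ F) (hq : ∀ y, q y = 0 → y = 0)
    (Φ : E → Set F) (hΦ : SetMap.IsPolyhedral Φ) (hne : (SetMap.graph Φ).Nonempty) :
    (SetMap.IsSublinear Φ → SetMap.IsRelSurjective Φ →
      SetMap.hoffman p q Φ ≠ ⊤ ∧
      SetMap.hoffman p q Φ = 1 / SetMap.dualMin p q Φ ∧
      SetMap.DualMinAttained p q Φ) ∧
    (∀ 𝔉 𝔍 : Set (Set (E × F)),
      𝔉 ⊆ SetMap.relSurjCones Φ →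
      𝔍 ⊆ SetMap.tangentCones (SetMap.graph Φ) \ SetMap.relSurjCones Φ →
      (∀ T ∈ SetMap.tangentCones (SetMap.graph Φ), (∃ K ∈ 𝔉, K ⊆ T) ∨ (∃ I ∈ 𝔍, T ⊆ I)) →
      SetMap.hoffman p q Φ ≠ ⊤ ∧
      IsGreatest ((fun T => SetMap.invNorm p q (SetMap.ofGraph T)) '' 𝔉)
        (SetMap.hoffman p q Φ) ∧
      IsGreatest ((fun T => 1 / SetMap.dualMin p q (SetMap.ofGraph T)) '' 𝔉)
        (SetMap.hoffman p q Φ) ∧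
      ∀ T ∈ 𝔉, SetMap.DualMinAttained p q (SetMap.ofGraph T)) := by
  refine ⟨?_, fun 𝔉 𝔍 hF hJ hcov => SetMap.hoffman_of_cover p hp q hq Φ hΦ hne hF hJ hcov⟩
  rintro ⟨K, hK⟩ hr
  have hsmul : ∀ c : ℝ, 0 < c → ∀ z ∈ SetMap.graph Φ, c • z ∈ SetMap.graph Φ := by
    rw [← hK]
    exact fun c hc z hz => K.smul_mem hc hz
  have h0 : (0 : E × F) ∈ SetMap.graph Φ := SetMap.IsPolyhedron.zero_mem hΦ hne hsmul
  have hF : {SetMap.graph Φ} ⊆ SetMap.relSurjCones Φ := by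
    rintro _ rfl
    exact ⟨⟨0, h0, (SetMap.tangentCone_zero_eq hsmul).symm⟩, hr⟩
  have hcov : ∀ T ∈ SetMap.tangentCones (SetMap.graph Φ),
      (∃ S ∈ ({SetMap.graph Φ} : Set (Set (E × F))), S ⊆ T) ∨
        ∃ I ∈ (∅ : Set (Set (E × F))), T ⊆ I := by
    rintro _ ⟨z, hz, rfl⟩
    -- A convex cone is closed under addition, so it lies in each of its tangent cones.
    refine Or.inl ⟨_, rfl, fun d hd => ⟨1, one_pos, ?_⟩⟩
    rw [one_smul]
    rw [← hK] at hz hd ⊢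
    exact K.add_mem hz hd
  obtain ⟨hfin, -, hgr, hatt⟩ :=
    SetMap.hoffman_of_cover p hp q hq Φ hΦ hne hF (Set.empty_subset _) hcov
  refine ⟨hfin, ?_, hatt _ rfl⟩
  rw [Set.image_singleton] at hgr
  exact hgr.1
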